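/- Let $q$ be a prime power, let $m,\ell,\eta$ be positive integers and let $n=\ell\eta$. Write a vector $x\in\mathbb F_{q^m}^n$ as $x=[x_1|\dots|x_\ell]$ with $\ell$ consecutive blocks $x_i\in\mathbb F_{q^m}^{\eta}$. Let $\mathrm{rk}_q(x_i)$ be the rank of the $m\times\eta$ matrix over $\mathbb F_q$ whose columns are the coordinate vectors of the entries of $x_i$ in an $\mathbb F_q$-basis of $\mathbb F_{q^m}$, and let $d_{SR,\ell}(x,y)=\sum_{i=1}^{\ell}\mathrm{rk}_q(x_i-y_i)$ be the sum-rank distance. For an integer $\rho\ge 0$ let $\mathcal K_{SR,\ell}(\mathbb F_{q^m}^n,\rho)$ be the minimum cardinality of a (not necessarily linear) code $\mathcal C\subseteq\mathbb F_{q^m}^n$ such that every vector of $\mathbb F_{q^m}^n$ is at sum-rank distance at most $\rho$ from some element of $\mathcal C$. **Theorem.** Let $\rho$ be a positive integer, let $0\le l\le n$, and let $(n_0,\rho_0),\dots,(n_{l-1},\rho_{l-1})$ be pairs of integers with $\sum_{i=0}^{l-1}n_i=n$ and $\sum_{i=0}^{l-1}\rho_i=\rho$ such that, for every $0\le i\le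 l-1$, (i) $0<n_i\le n$, (ii) $0\le\rho_i\le n_i$, (iii) $n_i+\rho_i\le m$. Then $$\mathcal K_{SR,\ell}(\mathbb F_{q^m}^n,\rho)\;\le\; q^{\,m(n-\rho)-\sum_{i=0}^{l-1}\lfloor \rho_i/\ell\rfloor\,(n_i-\rho_i)} .$$ Equivalently, if there are such $l$ and $(n_i,\rho_i)$ at all, then $\mathcal K_{SR,\ell}(\mathbb F_{q^m}^n,\rho)$ is at most the minimum of the right-hand side over all of them. (The $n_i$ need not be divisible by $\ell$.) -/

import Mathlib

namespace SumRank

noncomputable section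

/-- The matrix over `F` whose `j`-th column holds the coordinates of `x j`
in a basis of `E` over `F`. -/
def expand (F : Type*) {E : Type*} [Field F] [Field E] [Algebra F E] [FiniteDimensional F E]
    {k : ℕ} (x : Fin k → E) : Matrix (Fin (Module.finrank F E)) (Fin k) F :=
  fun a j => (Module.finBasis F E).repr (x j) a

/-- The rank over `F` of a vector with entries in `E`. -/
def rk (F : Type*) {E : Type*} [Field F] [Field E] [Algebra F E] [FiniteDimensional F E]
    {k : ℕ} (x : Fin k → E) : ℕ :=
  (expand F x).rank

/-- The rank does not depend on the basis: it is the dimension of the `F`-span of the entries. -/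
theorem rk_eq_finrank_span (F : Type*) {E : Type*} [Field F] [Field E] [Algebra F E]
    [FiniteDimensional F E] {k : ℕ} (x : Fin k → E) :
    rk F x = Module.finrank F (Submodule.span F (Set.range x)) := by
  have h : Set.range (expand F x).col = (Module.finBasis F E).equivFun '' Set.range x := by
    rw [← Set.range_comp]
    rfl
  rw [rk, Matrix.rank_eq_finrank_span_cols, h]
  have h2 := Submodule.map_span (Module.finBasis F E).equivFun.toLinearMap (Set.range x)
  have h3 := LinearEquiv.finrank_map_eq (Module.finBasis F E).equivFun
    (Submodule.span F (Set.range x))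
  rw [← h3, h2]
  rfl

/-- The `i`-th of the `l` consecutive blocks of length `e` of a vector of length `l * e`:
its `j`-th entry is the entry of `x` at position `e * i + j`. -/
def block {E : Type*} {l e : ℕ} (x : Fin (l * e) → E) (i : Fin l) : Fin e → E :=
  fun j => x (finProdFinEquiv (i, j))

/-- The sum-rank weight of a vector made of `l` blocks of length `e`. -/
def weight (F : Type*) {E : Type*} [Field F] [Field E] [Algebra F E] [FiniteDimensional F E]
    {l e : ℕ} (x : Fin (l * e) → E) : ℕ :=
  ∑ i : Fin l, rk F (block x i)

/-- The sum-rank distance. -/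
def dist (F : Type*) {E : Type*} [Field F] [Field E] [Algebra F E] [FiniteDimensional F E]
    {l e : ℕ} (x y : Fin (l * e) → E) : ℕ :=
  weight F (x - y)

/-- The ball of sum-rank radius `r` around `x`. -/
def ball (F : Type*) {E : Type*} [Field F] [Field E] [Algebra F E] [FiniteDimensional F E]
    {l e : ℕ} (x : Fin (l * e) → E) (r : ℕ) : Set (Fin (l * e) → E) :=
  {y | dist F x y ≤ r}

/-- The balls of sum-rank radius `r` around the codewords of `C` cover the whole space. -/
def Covers (F : Type*) {E : Type*} [Field F] [Field E] [Algebra F E] [FiniteDimensional F E]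
    {l e : ℕ} (C : Finset (Fin (l * e) → E)) (r : ℕ) : Prop :=
  (⋃ c ∈ C, ball F c r) = Set.univ

/-- The minimum cardinality of a code in `E ^ (l * e)`, for vectors made of `l` blocks of
length `e`, whose balls of sum-rank radius `r` cover the space. -/
def minCard (F E : Type*) [Field F] [Field E] [Algebra F E] [FiniteDimensional F E]
    (l e r : ℕ) : ℕ :=
  sInf {k | ∃ C : Finset (Fin (l * e) → E), Covers F C r ∧ C.card = k}

/-- Over a finite field the minimum is attained. -/
theorem exists_covers_card_eq_minCard (F E : Type*) [Field F] [Finite F] [Field E]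
    [Algebra F E] [FiniteDimensional F E] (l e r : ℕ) :
    ∃ C : Finset (Fin (l * e) → E), Covers F C r ∧ C.card = minCard F E l e r := by
  have hE : Finite E := Module.finite_of_finite F
  have : Fintype (Fin (l * e) → E) := Fintype.ofFinite _
  refine Nat.sInf_mem (s := {k | ∃ C : Finset (Fin (l * e) → E), Covers F C r ∧ C.card = k})
    ⟨_, Finset.univ, ?_, rfl⟩
  refine Set.eq_univ_of_forall fun x => Set.mem_iUnion₂.2 ⟨x, Finset.mem_univ _, ?_⟩
  have h0 : ∀ i, rk F (block (x - x) i) = 0 := fun i => by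
    have h : Submodule.span F (Set.range (block (x - x) i)) = ⊥ := by
      rw [Submodule.span_eq_bot]
      rintro _ ⟨j, rfl⟩
      exact sub_self _
    rw [rk_eq_finrank_span, h, finrank_bot]
  have h1 : dist F x x = 0 := by
    rw [dist, weight]
    exact Finset.sum_eq_zero fun i _ => h0 i
  exact h1.le.trans r.zero_le

end

end SumRank

/-!
The covering code is a product of linear codes, one for each of the `l` groups of consecutive
coordinates of lengths `ns i`; each is a Gabidulin code over an extension of `F` of degree at most `m`.

Consider one group, of length `N` and radius `ρ`, and put `r = ρ / ℓ`. Let `K` be an extension of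
`F` of degree `m - r`, identify `E` with `K × F ^ r` as an `F`-vector space, and choose
`a₁, …, a_N` in `K` linearly independent over `F`. The code consists of the words whose
`F ^ r`-component vanishes and whose `K`-component `y` has zero syndrome
`(∑ j, a_j ^ (q ^ i) * y_j)` for `i < ρ`; it has `q ^ ((m - r) * (N - ρ))` elements.

It covers for the following reason. Given `x`, the restrictions to single blocks of the `r` columns
of its `F ^ r`-component are at most `r * ℓ ≤ ρ` vectors of `F ^ N`. Hence there are `ρ` linearly
independent vectors `u_k`, each supported in one block, whose span contains these columns
(`exists_linearIndependent_block_supported`). Errors of the form `∑ k, u_k • e_k` with `e_k` in `E`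
have sum-rank weight at most `ρ`, since `e_k` contributes to one block only. The `F ^ r`-components
of the `e_k` are chosen so that the error has the same `F ^ r`-component as `x`. Their
`K`-components can be chosen so that the error has the same syndrome as `x`, because
`b_k = ∑ j, u_k j • a_j` are linearly independent and the Moore matrix `(b_k ^ (q ^ i))` is
therefore invertible (`exists_sum_mul_pow_eq`). The difference of `x` and the error is a codeword
(`exists_code`).

The groups need not be aligned with the blocks: the errors of different groups add up inside a
block, and the dimension of a sum of subspaces is at most the sum of their dimensions.
-/

namespace SumRank

/-! ### Moore matrices -/

theorem exists_algHom_apply_eq_pow (F K : Type*) [Field F] [Finite F] [Field K] [Algebra F K]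
    (i : ℕ) : ∃ σ : K →ₐ[F] K, ∀ y, σ y = y ^ Nat.card F ^ i := by
  have := Fintype.ofFinite F
  refine ⟨FiniteField.frobeniusAlgHom F K ^ i, fun y => ?_⟩
  rw [AlgHom.coe_pow, FiniteField.coe_frobeniusAlgHom, pow_iterate, Nat.card_eq_fintype_card]

/-- The Moore matrix `(b k ^ (q ^ i))` of a linearly independent family is invertible, stated as
solvability of the linear systems with this matrix. -/
theorem exists_sum_mul_pow_eq (F : Type*) {K : Type*} [Field F] [Finite F] [Field K] [Algebra F K]
    {r : ℕ} {b : Fin r → K} (hb : LinearIndependent F b) (s : Fin r → K) :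
    ∃ z : Fin r → K, ∀ i : Fin r, ∑ k, z k * b k ^ Nat.card F ^ (i : ℕ) = s i := by
  classical
  set q := Nat.card F with hq
  have hq1 : 1 < q := Finite.one_lt_card
  have := Fintype.ofFinite F
  choose σ hσ using exists_algHom_apply_eq_pow F K
  let M : Matrix (Fin r) (Fin r) K := fun i k => b k ^ q ^ (i : ℕ)
  have hdet : M.det ≠ 0 := by
    intro h0
    obtain ⟨c, hc0, hc⟩ := Matrix.exists_vecMul_eq_zero_iff.2 h0
    -- A linear relation between the rows is a `q`-polynomial of `q`-degree less than `r`
    -- vanishing on the span of the `b k`, which has `q ^ r` elements.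
    let f : K →ₗ[F] K := ∑ i : Fin r, c i • (σ i).toLinearMap
    have hf (y : K) : f y = ∑ i : Fin r, c i * y ^ q ^ (i : ℕ) := by
      simp [f, hσ, hq]
    let P : Polynomial K := ∑ i : Fin r, Polynomial.monomial (q ^ (i : ℕ)) (c i)
    have hP (y : K) : P.eval y = f y := by
      simp [P, hf, Polynomial.eval_finsetSum]
    have hfb (k : Fin r) : f (b k) = 0 := by
      rw [hf]
      exact congrFun hc k
    let y : (Fin r → F) → K := fun d => ∑ k, d k • b k
    have hy : Function.Injective y := hb.fintypeLinearCombination_injective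
    have hP0 : P = 0 := by
      refine Polynomial.eq_zero_of_natDegree_lt_card_of_eval_eq_zero P hy (fun d => ?_) ?_
      · rw [hP]
        simp [y, hfb]
      · have hr : 0 < r := by
          by_contra hr
          obtain rfl : r = 0 := by omega
          exact hc0 (Subsingleton.elim _ _)
        rw [Fintype.card_fun, Fintype.card_fin, ← Nat.card_eq_fintype_card, ← hq]
        refine lt_of_le_of_lt (Polynomial.natDegree_sum_le_of_forall_le (n := q ^ (r - 1)) _ _
          fun i _ => ?_) (Nat.pow_lt_pow_right hq1 (Nat.sub_lt hr one_pos))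
        exact (Polynomial.natDegree_monomial_le _).trans
          (Nat.pow_le_pow_right (by omega) (by omega))
    apply hc0
    funext i
    have h1 : P.coeff (q ^ (i : ℕ)) = c i := by
      simp only [P, Polynomial.finsetSum_coeff, Polynomial.coeff_monomial]
      rw [Finset.sum_eq_single i]
      · simp
      · intro j _ hj
        rw [if_neg]
        exact fun h => hj (Fin.ext (Nat.pow_right_injective hq1 h))
      · simp
    rw [← h1, hP0]
    rfl
  refine ⟨M⁻¹.mulVec s, fun i => ?_⟩
  have h1 : M.mulVec (M⁻¹.mulVec s) = s := by
    rw [Matrix.mulVec_mulVec, Matrix.mul_nonsing_inv _ (isUnit_iff_ne_zero.2 hdet),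
      Matrix.one_mulVec]
  conv_rhs => rw [← h1]
  simp [Matrix.mulVec, dotProduct, M, mul_comm]

/-! ### Independent vectors supported in blocks -/

/-- If `ρ` is at least the number of restrictions of the vectors `v t` to single fibres of `b`, then
the `v t` lie in the span of `ρ` linearly independent vectors, each supported in one fibre. -/
theorem exists_linearIndependent_block_supported {F J B τ : Type*} [Field F] [Fintype J]
    [Fintype B] [Fintype τ] (b : J → B) (v : τ → J → F) {ρ : ℕ}
    (h1 : Fintype.card τ * Fintype.card B ≤ ρ) (h2 : ρ ≤ Fintype.card J) :
    ∃ (u : Fin ρ → J → F) (β : Fin ρ → B), LinearIndependent F u ∧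
      (∀ k j, b j ≠ β k → u k j = 0) ∧ ∀ t, v t ∈ Submodule.span F (Set.range u) := by
  classical
  let T : Set (J → F) := {f | ∃ β, ∀ j, b j ≠ β → f j = 0}
  let g : τ × B → J → F := fun p j => if b j = p.2 then v p.1 j else 0
  have hgT : Set.range g ⊆ T := by
    rintro _ ⟨p, rfl⟩
    exact ⟨p.2, fun j hj => if_neg hj⟩
  have hT : Submodule.span F T = ⊤ := by
    rw [eq_top_iff, ← (Pi.basisFun F J).span_eq, Submodule.span_le]
    rintro _ ⟨j, rfl⟩
    refine Submodule.subset_span ⟨b j, fun j' hj' => ?_⟩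
    rw [Pi.basisFun_apply, Pi.single_eq_of_ne]
    rintro rfl
    exact hj' rfl
  -- Extend an independent part `S` of the restricted vectors `g` to a basis `D` inside `T`, and take
  -- `ρ` vectors between `S` and `D`.
  obtain ⟨S, hSg, hgS, hS⟩ := exists_linearIndependent F (Set.range g)
  have hS : LinearIndepOn F id S := hS
  have hST : S ⊆ T := hSg.trans hgT
  have hindep := hS.linearIndepOn_extend hST
  have hspan := hS.span_extend_eq_span hST
  have hsub := hS.extend_subset hST
  have hSsub := hS.subset_extend hST
  set D := hS.extend hST
  have hcard : D.ncard = Fintype.card J := by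
    let bas : Module.Basis D F (J → F) := Module.Basis.mk
      (v := ((↑) : D → J → F)) hindep.linearIndependent (by simp [hspan, hT])
    rw [← Nat.card_coe_set_eq, ← Module.finrank_eq_nat_card_basis bas, Module.finrank_pi]
  have hSρ : S.ncard ≤ ρ :=
    calc S.ncard ≤ (Set.range g).ncard := Set.ncard_le_ncard hSg (Set.finite_range g)
      _ ≤ Nat.card (τ × B) := by
        rw [← Set.image_univ, ← Set.ncard_univ]
        exact Set.ncard_image_le
      _ ≤ ρ := by simpa using h1
  obtain ⟨M, hSM, hMD, hM⟩ := Set.exists_subsuperset_card_eq hSsub hSρ (hcard ▸ h2)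
  have : Finite M := (hindep.mono hMD).linearIndependent.finite
  let e : Fin ρ ≃ M := (Finite.equivFinOfCardEq (by rw [Nat.card_coe_set_eq, hM])).symm
  have hβ : ∀ k, ∃ β, ∀ j, b j ≠ β → (e k : J → F) j = 0 := fun k => hsub (hMD (e k).2)
  choose β hβ using hβ
  refine ⟨fun k => e k, β, (hindep.mono hMD).linearIndependent.comp e e.injective, hβ, fun t => ?_⟩
  have hr : Set.range (fun k => (e k : J → F)) = M :=
    (e.surjective.range_comp ((↑) : M → J → F)).trans Subtype.range_coe
  have hv : v t = ∑ β, g (t, β) := by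
    funext j
    simp [g, Finset.sum_apply]
  rw [hr, hv]
  refine Submodule.sum_mem _ fun β _ => Submodule.span_mono hSM ?_
  rw [hgS]
  exact Submodule.subset_span ⟨_, rfl⟩

/-! ### The code for one group of coordinates -/

theorem exists_field_extension (F : Type*) [Field F] [Finite F] (d : ℕ) (hd : 0 < d) :
    ∃ (K : Type) (_ : Field K) (_ : Algebra F K), Module.finrank F K = d := by
  obtain ⟨p, _⟩ := CharP.exists F
  have : Fact p.Prime := ⟨CharP.char_is_prime F p⟩
  have : NeZero d := ⟨hd.ne'⟩
  exact ⟨FiniteField.Extension F p d, inferInstance, inferInstance,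
    FiniteField.finrank_extension F p d⟩

/-- A Gabidulin code over an extension of `F` of degree `m - r`, viewed in `E ^ J`, covers `E ^ J`
with sum-rank radius `ρ` when `r` times the number of blocks is at most `ρ`. The blocks are the fibres of `b`,
and the weight bound is expressed through subspaces `W β` containing the entries in block `β`. -/
theorem exists_code {F E J B : Type*} [Field F] [Finite F] [Field E] [Algebra F E]
    [FiniteDimensional F E] [Fintype J] [Fintype B] (b : J → B) {ρ r : ℕ}
    (h1 : r * Fintype.card B ≤ ρ) (h2 : ρ ≤ Fintype.card J)
    (hJ : 0 < Fintype.card J) (h3 : Fintype.card J + r ≤ Module.finrank F E) :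
    ∃ C : Finset (J → E),
      C.card ≤ Nat.card F ^ ((Module.finrank F E - r) * (Fintype.card J - ρ)) ∧
      ∀ x : J → E, ∃ c ∈ C, ∃ W : B → Submodule F E,
        (∀ j, x j - c j ∈ W (b j)) ∧ ∑ β, Module.finrank F (W β) ≤ ρ := by
  classical
  set m := Module.finrank F E with hm
  obtain ⟨K, _, _, hK⟩ := exists_field_extension F (m - r) (by omega)
  have : FiniteDimensional F K := FiniteDimensional.of_finrank_pos (by omega)
  have : Finite K := Module.finite_of_finite F
  have : Finite E := Module.finite_of_finite F
  obtain ⟨φ⟩ : Nonempty (E ≃ₗ[F] K × (Fin r → F)) :=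
    FiniteDimensional.nonempty_linearEquiv_of_finrank_eq (by
      rw [Module.finrank_prod, Module.finrank_fin_fun, hK]; omega)
  obtain ⟨a, ha⟩ : ∃ a : J → K, LinearIndependent F a := by
    obtain ⟨f, hf⟩ := exists_linearIndependent_of_le_finrank
      (R := F) (M := K) (n := Fintype.card J) (by omega)
    exact ⟨f ∘ Fintype.equivFin J, hf.comp _ (Equiv.injective _)⟩
  -- The syndrome map of the Gabidulin code.
  let H : (J → K) →ₗ[K] (Fin ρ → K) :=
    LinearMap.pi fun i => ∑ j, (a j ^ Nat.card F ^ (i : ℕ)) • LinearMap.proj j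
  have hH (y : J → K) (i : Fin ρ) : H y i = ∑ j, a j ^ Nat.card F ^ (i : ℕ) * y j := by
    simp [H]
  -- Combinations of any `ρ` independent vectors over `F` realize every syndrome.
  have key (u : Fin ρ → J → F) (hu : LinearIndependent F u) (s : Fin ρ → K) :
      ∃ z : Fin ρ → K, H (fun j => ∑ k, u k j • z k) = s := by
    have hb : LinearIndependent F (fun k => Fintype.linearCombination F a (u k)) :=
      hu.map' _ (LinearMap.ker_eq_bot.2 ha.fintypeLinearCombination_injective)
    obtain ⟨z, hz⟩ := exists_sum_mul_pow_eq F hb s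
    refine ⟨z, funext fun i => ?_⟩
    rw [hH, ← hz]
    obtain ⟨σ, hσ⟩ := exists_algHom_apply_eq_pow F K i
    simp only [← hσ, Fintype.linearCombination_apply, map_sum, map_smul, Finset.mul_sum]
    rw [Finset.sum_comm]
    refine Finset.sum_congr rfl fun k _ => Finset.sum_congr rfl fun j _ => ?_
    rw [mul_smul_comm, mul_smul_comm, mul_comm]
  have hsurj : LinearMap.range H = ⊤ := by
    -- Only the independence of some `ρ` vectors matters here, so the list to be spanned is empty.
    obtain ⟨u, -, hu, -⟩ := exists_linearIndependent_block_supported (F := F) b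
      (fun t : Fin 0 => t.elim0) (by simp) h2
    refine LinearMap.range_eq_top.2 fun s => ?_
    obtain ⟨z, hz⟩ := key u hu s
    exact ⟨_, hz⟩
  have hker : Module.finrank K (LinearMap.ker H) = Fintype.card J - ρ := by
    have h := H.finrank_range_add_finrank_ker
    rw [hsurj, finrank_top, Module.finrank_fin_fun, Module.finrank_pi] at h
    omega
  have := Fintype.ofFinite (LinearMap.ker H)
  refine ⟨Finset.univ.image fun y : LinearMap.ker H => fun j => φ.symm (y.1 j, 0),
    Finset.card_image_le.trans ?_, fun x => ?_⟩
  · rw [Finset.card_univ, ← Nat.card_eq_fintype_card, Module.natCard_eq_pow_finrank (K := K), hker,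
      Module.natCard_eq_pow_finrank (K := F) (V := K), hK, ← pow_mul]
  · obtain ⟨u, β, hu, hβ, hv⟩ := exists_linearIndependent_block_supported (F := F) b
      (fun (t : Fin r) j => (φ (x j)).2 t) (by simpa using h1) h2
    choose w hw using fun t => (Submodule.mem_span_range_iff_exists_fun F).1 (hv t)
    obtain ⟨z, hz⟩ := key u hu (H fun j => (φ (x j)).1)
    let y : J → K := fun j => (φ (x j)).1 - ∑ k, u k j • z k
    have hy : y ∈ LinearMap.ker H := by
      rw [LinearMap.mem_ker]
      change H ((fun j => (φ (x j)).1) - fun j => ∑ k, u k j • z k) = 0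
      rw [map_sub, hz, sub_self]
    let e : Fin ρ → E := fun k => φ.symm (z k, fun t => w t k)
    refine ⟨_, Finset.mem_image_of_mem _ (Finset.mem_univ ⟨y, hy⟩),
      fun β' => Submodule.span F (Set.range fun k : {k // β k = β'} => e k), fun j => ?_, ?_⟩
    · have hx : x j - φ.symm (y j, 0) = ∑ k, u k j • e k := by
        apply φ.injective
        simp only [map_sub, map_sum, map_smul, LinearEquiv.apply_symm_apply, e]
        refine Prod.ext ?_ (funext fun t => ?_)
        · simp [y, Prod.fst_sum]
        · have := congrFun (hw t) j
          simp only [Finset.sum_apply, Pi.smul_apply, smul_eq_mul] at this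
          simp [Prod.snd_sum, ← this, mul_comm]
      rw [hx]
      refine Submodule.sum_mem _ fun k _ => ?_
      by_cases hk : b j = β k
      · exact Submodule.smul_mem _ _ (Submodule.subset_span ⟨⟨k, hk.symm⟩, rfl⟩)
      · rw [hβ k j hk, zero_smul]
        exact Submodule.zero_mem _
    · calc _ ≤ ∑ β', Fintype.card {k // β k = β'} :=
            Finset.sum_le_sum fun β' _ => finrank_range_le_card _
        _ = Fintype.card (Σ β', {k // β k = β'}) := Fintype.card_sigma.symm
        _ = ρ := by rw [Fintype.card_congr (Equiv.sigmaFiberEquiv β), Fintype.card_fin]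
        _ ≤ ρ := le_rfl


/-! ### Combination of the groups -/

theorem finrank_iSup_le {F V ι : Type*} [Field F] [AddCommGroup V] [Module F V]
    [FiniteDimensional F V] [Fintype ι] (W : ι → Submodule F V) :
    Module.finrank F ↥(⨆ i, W i) ≤ ∑ i, Module.finrank F (W i) := by
  classical
  rw [← Finset.sup_univ_eq_iSup]
  induction (Finset.univ : Finset ι) using Finset.induction_on with
  | empty => simp
  | insert i s hi ih =>
    rw [Finset.sup_insert, Finset.sum_insert hi]
    exact (Submodule.finrank_add_le_finrank_add_finrank _ _).trans (by gcongr)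

end SumRank

theorem mainTheorem11 {F E : Type*} [Field F] [Finite F] [Field E] [Algebra F E]
    [FiniteDimensional F E] (q m : ℕ) (hq : Nat.card F = q) (hm : Module.finrank F E = m)
    (n ℓ η ρ : ℕ) (hℓ : 0 < ℓ) (hη : 0 < η) (hn : n = ℓ * η) (hρ : 0 < ρ)
    (l : ℕ) (hl : l ≤ n) (ns ρs : Fin l → ℕ)
    (h1 : ∀ i, 0 < ns i ∧ ns i ≤ n)
    (h2 : ∀ i, 0 ≤ ρs i ∧ ρs i ≤ ns i)
    (h3 : ∀ i, ns i + ρs i ≤ m)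
    (hns : ∑ i, ns i = n) (hρs : ∑ i, ρs i = ρ) :
    (SumRank.minCard F E ℓ η ρ : ℝ) ≤
      (q : ℝ) ^ ((m : ℤ) * ((n : ℤ) - (ρ : ℤ)) -
        ∑ i : Fin l, ((ρs i / ℓ : ℕ) : ℤ) * ((ns i : ℤ) - (ρs i : ℤ))) := by
  classical
  subst hn hm hq hρs
  -- The coordinates, split into groups of consecutive positions of lengths `ns i`.
  let e : (Σ i, Fin (ns i)) ≃ Fin (ℓ * η) := finSigmaFinEquiv.trans (finCongr hns)
  have hr (i : Fin l) : ρs i / ℓ ≤ ρs i := Nat.div_le_self _ _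
  have hcode (i : Fin l) := SumRank.exists_code (F := F) (E := E) (ρ := ρs i) (r := ρs i / ℓ)
    (fun j : Fin (ns i) => (finProdFinEquiv.symm (e ⟨i, j⟩)).1)
    (by simpa using Nat.div_mul_le_self _ _) (by simpa using (h2 i).2) (by simpa using (h1 i).1)
    (by have := h3 i; have := hr i; rw [Fintype.card_fin]; omega)
  simp only [Fintype.card_fin] at hcode
  choose C hcard hC using hcode
  let D : Finset (Fin (ℓ * η) → E) :=
    (Fintype.piFinset C).image fun c k => c (e.symm k).1 (e.symm k).2
  have hD : SumRank.Covers F D (∑ i, ρs i) := by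
    refine Set.eq_univ_of_forall fun x => ?_
    choose c hc W hW hWρ using fun i => hC i fun j => x (e ⟨i, j⟩)
    let d : Fin (ℓ * η) → E := fun k => c (e.symm k).1 (e.symm k).2
    have hd : d ∈ D := Finset.mem_image_of_mem _ (Fintype.mem_piFinset.2 hc)
    refine Set.mem_iUnion₂.2 ⟨d, hd, ?_⟩
    have hdc (p : Σ i, Fin (ns i)) : d (e p) = c p.1 p.2 := by
      simp only [d]
      rw [e.symm_apply_apply]
    have hmem (k : Fin (ℓ * η)) : d k - x k ∈ ⨆ i, W i (finProdFinEquiv.symm k).1 := by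
      obtain ⟨⟨i, j⟩, rfl⟩ := e.surjective k
      have := Submodule.mem_iSup_of_mem (p := fun i' => W i' (finProdFinEquiv.symm (e ⟨i, j⟩)).1)
        i (hW i j)
      rw [← neg_sub, hdc ⟨i, j⟩]
      exact Submodule.neg_mem _ this
    calc SumRank.dist F d x ≤ ∑ β, ∑ i, Module.finrank F (W i β) := by
          rw [SumRank.dist, SumRank.weight]
          refine Finset.sum_le_sum fun β _ => ?_
          rw [SumRank.rk_eq_finrank_span]
          refine (Submodule.finrank_mono (Submodule.span_le.2 ?_)).trans
            (SumRank.finrank_iSup_le fun i => W i β)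
          rintro _ ⟨j, rfl⟩
          simpa [SumRank.block] using hmem (finProdFinEquiv (β, j))
      _ = ∑ i, ∑ β, Module.finrank F (W i β) := Finset.sum_comm
      _ ≤ ∑ i, ρs i := Finset.sum_le_sum fun i _ => hWρ i
  have hle : SumRank.minCard F E ℓ η (∑ i, ρs i) ≤
      Nat.card F ^ ∑ i, (Module.finrank F E - ρs i / ℓ) * (ns i - ρs i) :=
    calc SumRank.minCard F E ℓ η (∑ i, ρs i) ≤ D.card := Nat.sInf_le ⟨D, hD, rfl⟩
      _ ≤ ∏ i, (C i).card := Finset.card_image_le.trans (Fintype.card_piFinset C).le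
      _ ≤ _ := by
        rw [← Finset.prod_pow_eq_pow_sum]
        exact Finset.prod_le_prod' fun i _ => hcard i
  have hexp : (Module.finrank F E : ℤ) * (((ℓ * η : ℕ) : ℤ) - ((∑ i, ρs i : ℕ) : ℤ)) -
        ∑ i : Fin l, ((ρs i / ℓ : ℕ) : ℤ) * ((ns i : ℤ) - (ρs i : ℤ)) =
      ((∑ i, (Module.finrank F E - ρs i / ℓ) * (ns i - ρs i) : ℕ) : ℤ) := by
    rw [← hns, Nat.cast_sum, Nat.cast_sum, Nat.cast_sum, ← Finset.sum_sub_distrib, Finset.mul_sum,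
      ← Finset.sum_sub_distrib]
    refine Finset.sum_congr rfl fun i _ => ?_
    rw [Nat.cast_mul, Nat.cast_sub (h2 i).2,
      Nat.cast_sub ((hr i).trans ((Nat.le_add_left _ _).trans (h3 i)))]
    ring
  rw [hexp, zpow_natCast]
  exact_mod_cast hle
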